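/- Let $\mathcal{C}$ be a regular category, i.e. a category with finite limits in which every kernel pair has a coequaliser and regular epimorphisms are stable under pullback; fix a choice of finite products. For spans $X\leftarrow A\to Y$ and $X\leftarrow B\to Y$ write $(X\leftarrow A\to Y)\le(X\leftarrow B\to Y)$ if there is an arrow $A\to B$ commuting with the legs. Let $\mathsf{Span}^{\sim}(\mathcal{C})$ have the objects of $\mathcal{C}$ and, as arrows $X\to Y$, the spans $X\leftarrow A\to Y$ modulo the equivalence relation $\sim\;=\;\le\cap\ge$, composed by pullback. Let $\mathsf{Rel}(\mathcal{C})$ have the objects of $\mathcal{C}$ and, as arrows $X\to Y$, the jointly mono spans $X\leftarrow A\to Y$ (those for which $A\to X\times Y$ is mono) up to isomorphism; the composite of two of them is the image (regular epi-mono factorisation over $X\times Z$) of their composite as spans. Both are cartesian bicategories: the hom-sets are ordered by $\le$, the symmetric monoidal structure is induced by the finite products of $\mathcal{C}$, the comonoid on $X$ is given by the spans $X=X\xrightarrow{\Delta}X\times X$ and $X=X\to 1$, and the monoid on $X$ by the opposite spans. A morphism of cartesian bicategories is a (strong) monoidal functor that preserves the order on hom-sets and the chosen comonoids and monoids; it is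 an isomorphism if it is bijective on objects and an isomorphism of posets on hom-sets, and a biequivalence if it is essentially surjective and an isomorphism of posets on hom-sets. Then the following hold. 1. There is an isomorphism of cartesian bicategories $\mathsf{Span}^{\sim}(\mathcal{C})\cong\mathsf{Rel}(\mathcal{C})$ if and only if every regular epimorphism in $\mathcal{C}$ splits. 2. There is a biequivalence of cartesian bicategories $\mathsf{Span}^{\sim}(\mathcal{C})\to\mathsf{Rel}(\mathcal{C})$ if and only if every regular epimorphism in $\mathcal{C}$ splits. -/

import Mathlib

open CategoryTheory CategoryTheory.Limits MonoidalCategory CartesianMonoidalCategory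

universe v u

/-! ### Spans and the preorder on them -/

/-- Spans `X ← A → Y` in a category, with no condition on the legs. -/
abbrev CSpan {C : Type u} [Category.{v} C] (X Y : C) : Type (max u v) :=
  CategoryTheory.Span (⊤ : MorphismProperty C) (⊤ : MorphismProperty C) X Y

namespace CSpan

section Basic

variable {C : Type u} [Category.{v} C]

/-- The span with the given legs. -/
abbrev mk {X Y A : C} (l : A ⟶ X) (r : A ⟶ Y) : CSpan X Y := ⟨A, l, r, trivial, trivial⟩

/-- `S ≤ T` if there is a morphism of spans from `S` to `T`. -/
instance instPreorder (X Y : C) : Preorder (CSpan X Y) where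
  le S T := Nonempty (S ⟶ T)
  le_refl S := ⟨𝟙 S⟩
  le_trans _ _ _ := fun ⟨f⟩ ⟨g⟩ => ⟨f ≫ g⟩

/-- A pair of generalized elements `(a, b)` of `X` and `Y` is related by the span `S`
if it factors through `S`. -/
def Mem {X Y : C} (S : CSpan X Y) {P : C} (a : P ⟶ X) (b : P ⟶ Y) : Prop :=
  ∃ s : P ⟶ S.apex, s ≫ S.l = a ∧ s ≫ S.r = b

theorem le_iff {X Y : C} {S T : CSpan X Y} :
    S ≤ T ↔ ∀ (P : C) (a : P ⟶ X) (b : P ⟶ Y), S.Mem a b → T.Mem a b := by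
  constructor
  · rintro ⟨f⟩ P a b ⟨s, rfl, rfl⟩
    exact ⟨s ≫ f.hom, by simp, by simp⟩
  · intro h
    obtain ⟨s, h1, h2⟩ := h S.apex S.l S.r ⟨𝟙 _, by simp, by simp⟩
    exact ⟨⟨s, h1, h2⟩⟩

theorem Mem.precomp {X Y : C} {S : CSpan X Y} {P Q : C} {a : P ⟶ X} {b : P ⟶ Y}
    (h : S.Mem a b) (q : Q ⟶ P) : S.Mem (q ≫ a) (q ≫ b) := by
  obtain ⟨s, rfl, rfl⟩ := h
  exact ⟨q ≫ s, by simp, by simp⟩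

theorem mem_legs {X Y : C} (S : CSpan X Y) : S.Mem S.l S.r := ⟨𝟙 _, by simp, by simp⟩

theorem mem_mk {X Y A : C} (l : A ⟶ X) (r : A ⟶ Y) {P : C} (a : P ⟶ X) (b : P ⟶ Y) :
    (CSpan.mk l r).Mem a b ↔ ∃ s : P ⟶ A, s ≫ l = a ∧ s ≫ r = b := Iff.rfl

/-- The composite of two spans, formed with a pullback. -/
noncomputable abbrev comp [HasPullbacks C] {X Y Z : C} (S : CSpan X Y) (T : CSpan Y Z) :
    CSpan X Z :=
  CSpan.mk (pullback.fst S.r T.l ≫ S.l) (pullback.snd S.r T.l ≫ T.r)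

theorem mem_comp [HasPullbacks C] {X Y Z : C} (S : CSpan X Y) (T : CSpan Y Z) {P : C}
    (a : P ⟶ X) (c : P ⟶ Z) :
    (S.comp T).Mem a c ↔ ∃ b : P ⟶ Y, S.Mem a b ∧ T.Mem b c := by
  rw [mem_mk]
  constructor
  · rintro ⟨s, rfl, rfl⟩
    refine ⟨s ≫ pullback.fst S.r T.l ≫ S.r, ⟨s ≫ pullback.fst S.r T.l, by simp, by simp⟩,
      ⟨s ≫ pullback.snd S.r T.l, by simp [pullback.condition], by simp⟩⟩
  · rintro ⟨b, ⟨s, rfl, rfl⟩, ⟨t, h, rfl⟩⟩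
    exact ⟨pullback.lift s t h.symm, by rw [pullback.lift_fst_assoc],
      by rw [pullback.lift_snd_assoc]⟩

end Basic

section Cartesian

variable {C : Type u} [Category.{v} C] [CartesianMonoidalCategory C]

/-- The product of two spans. -/
abbrev tensor {X₁ Y₁ X₂ Y₂ : C} (S : CSpan X₁ Y₁) (T : CSpan X₂ Y₂) :
    CSpan (X₁ ⊗ X₂) (Y₁ ⊗ Y₂) :=
  CSpan.mk (S.l ⊗ₘ T.l) (S.r ⊗ₘ T.r)

theorem mem_tensor {X₁ Y₁ X₂ Y₂ : C} (S : CSpan X₁ Y₁) (T : CSpan X₂ Y₂) {P : C}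
    (a : P ⟶ X₁ ⊗ X₂) (b : P ⟶ Y₁ ⊗ Y₂) :
    (S.tensor T).Mem a b ↔
      S.Mem (a ≫ fst _ _) (b ≫ fst _ _) ∧ T.Mem (a ≫ snd _ _) (b ≫ snd _ _) := by
  constructor
  · rintro ⟨s, rfl, rfl⟩
    exact ⟨⟨s ≫ fst _ _, by simp, by simp⟩, ⟨s ≫ snd _ _, by simp, by simp⟩⟩
  · rintro ⟨⟨s, h1, h2⟩, ⟨t, h3, h4⟩⟩
    refine ⟨lift s t, ?_, ?_⟩ <;> ext <;> simp [h1, h2, h3, h4]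

/-- A span `X ← A → Y` is jointly mono if the induced arrow `A → X × Y` is mono. -/
def JointlyMono {X Y : C} (S : CSpan X Y) : Prop := Mono (lift S.l S.r)

end Cartesian

end CSpan

/-! ### Cartesian bicategories -/

open scoped ComonObj

/-- A cartesian bicategory: a symmetric monoidal category enriched in posets, each object of
which carries a cocommutative comonoid compatible with the monoidal structure (this part is
`CopyDiscardCategory`) whose operations have right adjoints satisfying the Frobenius law, and for
which every arrow is a lax comonoid homomorphism. -/
class CartesianBicategory (B : Type u) [Category.{v} B] [MonoidalCategory.{v} B]
    extends CopyDiscardCategory B where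
  /-- The order on hom-sets. -/
  homOrder (X Y : B) : PartialOrder (X ⟶ Y)
  comp_le_comp {X Y Z : B} {R R' : X ⟶ Y} {S S' : Y ⟶ Z} :
    R ≤ R' → S ≤ S' → R ≫ S ≤ R' ≫ S'
  tensor_le_tensor {X Y Z W : B} {R R' : X ⟶ Y} {S S' : Z ⟶ W} :
    R ≤ R' → S ≤ S' → (R ⊗ₘ S) ≤ (R' ⊗ₘ S')
  /-- The multiplication, right adjoint to copying. -/
  cocopy (X : B) : X ⊗ X ⟶ X
  /-- The unit, right adjoint to discarding. -/
  codiscard (X : B) : 𝟙_ B ⟶ X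
  id_le_copy_cocopy (X : B) : 𝟙 X ≤ Δ[X] ≫ cocopy X
  cocopy_copy_le_id (X : B) : cocopy X ≫ Δ[X] ≤ 𝟙 (X ⊗ X)
  id_le_discard_codiscard (X : B) : 𝟙 X ≤ ε[X] ≫ codiscard X
  codiscard_discard_le_id (X : B) : codiscard X ≫ ε[X] ≤ 𝟙 (𝟙_ B)
  frobenius_left (X : B) :
    (X ◁ Δ[X]) ≫ (α_ X X X).inv ≫ (cocopy X ▷ X) = cocopy X ≫ Δ[X]
  frobenius_right (X : B) :
    (Δ[X] ▷ X) ≫ (α_ X X X).hom ≫ (X ◁ cocopy X) = cocopy X ≫ Δ[X]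
  lax_copy {X Y : B} (R : X ⟶ Y) : R ≫ Δ[Y] ≤ Δ[X] ≫ (R ⊗ₘ R)
  lax_discard {X Y : B} (R : X ⟶ Y) : R ≫ ε[Y] ≤ ε[X]

namespace CartesianBicategory

attribute [reducible] homOrder
attribute [instance] homOrder

universe v₁ u₁ v₂ u₂

/-- A morphism of cartesian bicategories: a monoidal functor (with invertible structure maps)
preserving the order on hom-sets and the chosen comonoids and monoids. -/
structure Morphism (B : Type u₁) [Category.{v₁} B] [MonoidalCategory.{v₁} B]
    [CartesianBicategory B] (B' : Type u₂) [Category.{v₂} B'] [MonoidalCategory.{v₂} B']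
    [CartesianBicategory B'] where
  /-- The underlying functor. -/
  functor : B ⥤ B'
  /-- The monoidal structure of the underlying functor. -/
  [monoidal : functor.Monoidal]
  map_le_map {X Y : B} {R S : X ⟶ Y} : R ≤ S → functor.map R ≤ functor.map S
  map_copy (X : B) :
    functor.map Δ[X] = Δ[functor.obj X] ≫ Functor.LaxMonoidal.μ functor X X
  map_discard (X : B) :
    functor.map ε[X] = ε[functor.obj X] ≫ Functor.LaxMonoidal.ε functor
  map_cocopy (X : B) :
    functor.map (cocopy X) = Functor.OplaxMonoidal.δ functor X X ≫ cocopy (functor.obj X)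
  map_codiscard (X : B) :
    functor.map (codiscard X) = Functor.OplaxMonoidal.η functor ≫ codiscard (functor.obj X)

attribute [instance] Morphism.monoidal

variable {B : Type u₁} [Category.{v₁} B] [MonoidalCategory.{v₁} B] [CartesianBicategory B]
  {B' : Type u₂} [Category.{v₂} B'] [MonoidalCategory.{v₂} B'] [CartesianBicategory B']

/-- The morphism is an isomorphism on objects and on the posets of arrows, that is, it has a
strict inverse that is again a morphism of cartesian bicategories. -/
def Morphism.IsIsomorphism (F : Morphism B B') : Prop :=
  F.functor.IsIso ∧
    ∀ (X Y : B) (R S : X ⟶ Y), F.functor.map R ≤ F.functor.map S → R ≤ S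

/-- The morphism is essentially surjective on objects and an isomorphism on the posets of
arrows. -/
def Morphism.IsBiequivalence (F : Morphism B B') : Prop :=
  F.functor.IsEquivalence ∧
    ∀ (X Y : B) (R S : X ⟶ Y), F.functor.map R ≤ F.functor.map S → R ≤ S

end CartesianBicategory

/-! ### The category of spans modulo mutual inequality -/

/-- Equivalence classes of spans, where `S ∼ T` if `S ≤ T` and `T ≤ S`. -/
abbrev SpanClass {C : Type u} [Category.{v} C] (X Y : C) : Type (max u v) :=
  Antisymmetrization (CSpan X Y) (· ≤ ·)

namespace SpanClass

section Basic

variable {C : Type u} [Category.{v} C]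

/-- The class of a span. -/
abbrev mk {X Y : C} (S : CSpan X Y) : SpanClass X Y := toAntisymmetrization (· ≤ ·) S

/-- Pairs of generalized elements related by a class of spans. -/
def Mem {X Y : C} (R : SpanClass X Y) {P : C} (a : P ⟶ X) (b : P ⟶ Y) : Prop :=
  Quotient.liftOn' R (fun S => S.Mem a b) fun _ _ h =>
    propext ⟨CSpan.le_iff.1 h.1 P a b, CSpan.le_iff.1 h.2 P a b⟩

theorem mem_mk {X Y : C} (S : CSpan X Y) {P : C} (a : P ⟶ X) (b : P ⟶ Y) :
    (mk S).Mem a b ↔ S.Mem a b := Iff.rfl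

theorem ind {X Y : C} {p : SpanClass X Y → Prop} (h : ∀ S : CSpan X Y, p (mk S))
    (R : SpanClass X Y) : p R := Quotient.ind' h R

theorem mk_le_mk {X Y : C} {S T : CSpan X Y} : mk S ≤ mk T ↔ S ≤ T := Iff.rfl

theorem le_iff {X Y : C} {R R' : SpanClass X Y} :
    R ≤ R' ↔ ∀ (P : C) (a : P ⟶ X) (b : P ⟶ Y), R.Mem a b → R'.Mem a b := by
  induction R using ind with | h S
  induction R' using ind with | h S'
  exact CSpan.le_iff

theorem ext {X Y : C} {R R' : SpanClass X Y}
    (h : ∀ (P : C) (a : P ⟶ X) (b : P ⟶ Y), R.Mem a b ↔ R'.Mem a b) : R = R' :=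
  le_antisymm (le_iff.2 fun P a b => (h P a b).1) (le_iff.2 fun P a b => (h P a b).2)

theorem Mem.precomp {X Y : C} {R : SpanClass X Y} {P Q : C} {a : P ⟶ X} {b : P ⟶ Y}
    (h : R.Mem a b) (q : Q ⟶ P) : R.Mem (q ≫ a) (q ≫ b) := by
  induction R using ind with | h S
  exact CSpan.Mem.precomp h q

/-- The class of the span `X = X → Y` given by an arrow of the base category. -/
def graph {X Y : C} (f : X ⟶ Y) : SpanClass X Y := mk (CSpan.mk (𝟙 X) f)

/-- The class of the span `Y ← X = X` given by an arrow of the base category. -/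
def cograph {X Y : C} (f : X ⟶ Y) : SpanClass Y X := mk (CSpan.mk f (𝟙 X))

theorem mem_graph {X Y : C} (f : X ⟶ Y) {P : C} (a : P ⟶ X) (b : P ⟶ Y) :
    (graph f).Mem a b ↔ a ≫ f = b := by
  constructor
  · rintro ⟨s, rfl, rfl⟩
    simp
  · rintro rfl
    exact ⟨a, by simp, rfl⟩

theorem mem_cograph {X Y : C} (f : X ⟶ Y) {P : C} (b : P ⟶ Y) (a : P ⟶ X) :
    (cograph f).Mem b a ↔ a ≫ f = b := by
  constructor
  · rintro ⟨s, rfl, rfl⟩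
    simp
  · rintro rfl
    exact ⟨a, rfl, by simp⟩

variable [HasPullbacks C]

/-- Composition of classes of spans. -/
noncomputable def comp {X Y Z : C} (R : SpanClass X Y) (S : SpanClass Y Z) : SpanClass X Z :=
  Quotient.map₂ (sa := AntisymmRel.setoid _ _) (sb := AntisymmRel.setoid _ _)
    (sc := AntisymmRel.setoid _ _) CSpan.comp (by
      have key : ∀ {S S' : CSpan X Y} {T T' : CSpan Y Z}, S ≤ S' → T ≤ T' →
          S.comp T ≤ S'.comp T' := by
        intro S S' T T' h h'
        rw [CSpan.le_iff] at *
        intro P a c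
        rw [CSpan.mem_comp, CSpan.mem_comp]
        rintro ⟨b, h1, h2⟩
        exact ⟨b, h _ _ _ h1, h' _ _ _ h2⟩
      intro S S' h T T' h'
      exact ⟨key h.1 h'.1, key h.2 h'.2⟩) R S

theorem mem_comp {X Y Z : C} (R : SpanClass X Y) (S : SpanClass Y Z) {P : C}
    (a : P ⟶ X) (c : P ⟶ Z) :
    (R.comp S).Mem a c ↔ ∃ b : P ⟶ Y, R.Mem a b ∧ S.Mem b c := by
  induction R using ind with | h R
  induction S using ind with | h S
  exact CSpan.mem_comp R S a c

theorem mem_graph_comp {X Y Z : C} (f : X ⟶ Y) (S : SpanClass Y Z) {P : C}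
    (a : P ⟶ X) (c : P ⟶ Z) : ((graph f).comp S).Mem a c ↔ S.Mem (a ≫ f) c := by
  simp [mem_comp, mem_graph]

theorem mem_comp_graph {X Y Z : C} (R : SpanClass X Y) (e : Y ≅ Z) {P : C}
    (a : P ⟶ X) (c : P ⟶ Z) : (R.comp (graph e.hom)).Mem a c ↔ R.Mem a (c ≫ e.inv) := by
  simp only [mem_comp, mem_graph]
  constructor
  · rintro ⟨b, h, rfl⟩
    simpa using h
  · intro h
    exact ⟨_, h, by simp⟩

theorem graph_comp_graph {X Y Z : C} (f : X ⟶ Y) (g : Y ⟶ Z) :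
    (graph f).comp (graph g) = graph (f ≫ g) :=
  ext fun P a b => by simp [mem_graph_comp, mem_graph]

theorem comp_assoc {X Y Z W : C} (R : SpanClass X Y) (S : SpanClass Y Z) (T : SpanClass Z W) :
    (R.comp S).comp T = R.comp (S.comp T) :=
  ext fun P a b => by
    simp only [mem_comp]
    constructor
    · rintro ⟨c, ⟨d, h1, h2⟩, h3⟩
      exact ⟨d, h1, c, h2, h3⟩
    · rintro ⟨d, h1, c, h2, h3⟩
      exact ⟨c, ⟨d, h1, h2⟩, h3⟩

theorem comp_le_comp {X Y Z : C} {R R' : SpanClass X Y} {S S' : SpanClass Y Z}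
    (h : R ≤ R') (h' : S ≤ S') : R.comp S ≤ R'.comp S' := by
  rw [le_iff] at *
  intro P a c
  rw [mem_comp, mem_comp]
  rintro ⟨b, h1, h2⟩
  exact ⟨b, h _ _ _ h1, h' _ _ _ h2⟩

theorem id_le_graph_comp_cograph {X Y : C} (f : X ⟶ Y) :
    graph (𝟙 X) ≤ (graph f).comp (cograph f) := by
  rw [le_iff]
  intro P a b h
  rw [mem_graph] at h
  rw [mem_graph_comp, mem_cograph, ← h, Category.comp_id]

theorem cograph_comp_graph_le_id {X Y : C} (f : X ⟶ Y) :
    (cograph f).comp (graph f) ≤ graph (𝟙 Y) := by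
  rw [le_iff]
  intro P a b h
  rw [mem_comp] at h
  obtain ⟨c, h1, h2⟩ := h
  rw [mem_cograph] at h1
  rw [mem_graph] at h2 ⊢
  rw [← h1, ← h2, Category.comp_id]

end Basic

section Cartesian

variable {C : Type u} [Category.{v} C] [CartesianMonoidalCategory C]

/-- The product of classes of spans. -/
def tensor {X₁ Y₁ X₂ Y₂ : C} (R : SpanClass X₁ Y₁) (S : SpanClass X₂ Y₂) :
    SpanClass (X₁ ⊗ X₂) (Y₁ ⊗ Y₂) :=
  Quotient.map₂ (sa := AntisymmRel.setoid _ _) (sb := AntisymmRel.setoid _ _)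
    (sc := AntisymmRel.setoid _ _) CSpan.tensor (by
      have key : ∀ {S S' : CSpan X₁ Y₁} {T T' : CSpan X₂ Y₂}, S ≤ S' → T ≤ T' →
          S.tensor T ≤ S'.tensor T' := by
        intro S S' T T' h h'
        rw [CSpan.le_iff] at *
        intro P a c
        rw [CSpan.mem_tensor, CSpan.mem_tensor]
        rintro ⟨h1, h2⟩
        exact ⟨h _ _ _ h1, h' _ _ _ h2⟩
      intro S S' h T T' h'
      exact ⟨key h.1 h'.1, key h.2 h'.2⟩) R S

theorem mem_tensor {X₁ Y₁ X₂ Y₂ : C} (R : SpanClass X₁ Y₁) (S : SpanClass X₂ Y₂) {P : C}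
    (a : P ⟶ X₁ ⊗ X₂) (b : P ⟶ Y₁ ⊗ Y₂) :
    (R.tensor S).Mem a b ↔
      R.Mem (a ≫ fst _ _) (b ≫ fst _ _) ∧ S.Mem (a ≫ snd _ _) (b ≫ snd _ _) := by
  induction R using ind with | h R
  induction S using ind with | h S
  exact CSpan.mem_tensor R S a b

theorem tensor_le_tensor {X₁ Y₁ X₂ Y₂ : C} {R R' : SpanClass X₁ Y₁} {S S' : SpanClass X₂ Y₂}
    (h : R ≤ R') (h' : S ≤ S') : R.tensor S ≤ R'.tensor S' := by
  rw [le_iff] at *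
  intro P a c
  rw [mem_tensor, mem_tensor]
  rintro ⟨h1, h2⟩
  exact ⟨h _ _ _ h1, h' _ _ _ h2⟩

theorem graph_tensor_graph {X₁ Y₁ X₂ Y₂ : C} (f : X₁ ⟶ Y₁) (g : X₂ ⟶ Y₂) :
    (graph f).tensor (graph g) = graph (f ⊗ₘ g) :=
  ext fun P a b => by
    simp only [mem_tensor, mem_graph]
    constructor
    · rintro ⟨h1, h2⟩
      ext <;> simp [← h1, ← h2]
    · rintro rfl
      simp

/-- The symmetry of the cartesian product. -/
def prodSwap (X Y : C) : X ⊗ Y ≅ Y ⊗ X where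
  hom := lift (snd X Y) (fst X Y)
  inv := lift (snd Y X) (fst Y X)

section

variable [HasPullbacks C]

theorem tensor_comp_tensor {X₁ Y₁ Z₁ X₂ Y₂ Z₂ : C} (f₁ : SpanClass X₁ Y₁)
    (f₂ : SpanClass X₂ Y₂) (g₁ : SpanClass Y₁ Z₁) (g₂ : SpanClass Y₂ Z₂) :
    (f₁.tensor f₂).comp (g₁.tensor g₂) = (f₁.comp g₁).tensor (f₂.comp g₂) :=
  SpanClass.ext fun P a b => by
    simp only [mem_comp, mem_tensor]
    constructor
    · rintro ⟨c, ⟨h1, h2⟩, h3, h4⟩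
      exact ⟨⟨_, h1, h3⟩, ⟨_, h2, h4⟩⟩
    · rintro ⟨⟨c, h1, h3⟩, ⟨d, h2, h4⟩⟩
      exact ⟨lift c d, by simpa using ⟨h1, h2⟩, by simpa using ⟨h3, h4⟩⟩

theorem associator_naturality {X₁ X₂ X₃ Y₁ Y₂ Y₃ : C} (f₁ : SpanClass X₁ Y₁)
    (f₂ : SpanClass X₂ Y₂) (f₃ : SpanClass X₃ Y₃) :
    ((f₁.tensor f₂).tensor f₃).comp (graph (α_ Y₁ Y₂ Y₃).hom) =
      (graph (α_ X₁ X₂ X₃).hom).comp (f₁.tensor (f₂.tensor f₃)) :=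
  SpanClass.ext fun P a b => by
    simp [mem_comp_graph, mem_graph_comp, mem_tensor, and_assoc]

theorem leftUnitor_naturality {X Y : C} (f : SpanClass X Y) :
    ((graph (𝟙 (𝟙_ C))).tensor f).comp (graph (λ_ Y).hom) = (graph (λ_ X).hom).comp f :=
  SpanClass.ext fun P a b => by
    simp only [mem_comp_graph, mem_graph_comp, mem_tensor, mem_graph]
    simp [leftUnitor_hom, toUnit_unique (a ≫ fst _ _) (toUnit _)]

theorem rightUnitor_naturality {X Y : C} (f : SpanClass X Y) :
    (f.tensor (graph (𝟙 (𝟙_ C)))).comp (graph (ρ_ Y).hom) = (graph (ρ_ X).hom).comp f :=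
  SpanClass.ext fun P a b => by
    simp only [mem_comp_graph, mem_graph_comp, mem_tensor, mem_graph]
    simp [rightUnitor_hom, toUnit_unique (a ≫ snd _ _) (toUnit _)]

theorem prodSwap_naturality {X₁ Y₁ X₂ Y₂ : C} (f : SpanClass X₁ Y₁) (g : SpanClass X₂ Y₂) :
    (f.tensor g).comp (graph (prodSwap Y₁ Y₂).hom) =
      (graph (prodSwap X₁ X₂).hom).comp (g.tensor f) :=
  SpanClass.ext fun P a b => by
    rw [mem_comp_graph, mem_graph_comp, mem_tensor, mem_tensor]
    simp [prodSwap, and_comm]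

theorem frobenius_left (X : C) :
    ((graph (𝟙 X)).tensor (graph (lift (𝟙 X) (𝟙 X)))).comp
      ((graph (α_ X X X).inv).comp ((cograph (lift (𝟙 X) (𝟙 X))).tensor (graph (𝟙 X)))) =
      (cograph (lift (𝟙 X) (𝟙 X))).comp (graph (lift (𝟙 X) (𝟙 X))) :=
  SpanClass.ext fun P a b => by
    rw [graph_tensor_graph, mem_graph_comp, mem_graph_comp]
    simp only [mem_tensor, mem_cograph, mem_graph, mem_comp]
    constructor
    · rintro ⟨h1, h2⟩
      have h3 := congrArg (· ≫ fst _ _) h1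
      have h4 := congrArg (· ≫ snd _ _) h1
      simp at h2 h3 h4
      have h5 := h3.symm.trans h4
      refine ⟨b ≫ fst _ _, ?_, ?_⟩ <;> ext <;> simp [← h2, h3, h5]
    · rintro ⟨c, rfl, rfl⟩
      refine ⟨?_, ?_⟩
      · ext <;> simp
      · simp

theorem frobenius_right (X : C) :
    ((graph (lift (𝟙 X) (𝟙 X))).tensor (graph (𝟙 X))).comp
      ((graph (α_ X X X).hom).comp ((graph (𝟙 X)).tensor (cograph (lift (𝟙 X) (𝟙 X))))) =
      (cograph (lift (𝟙 X) (𝟙 X))).comp (graph (lift (𝟙 X) (𝟙 X))) :=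
  SpanClass.ext fun P a b => by
    rw [graph_tensor_graph, mem_graph_comp, mem_graph_comp]
    simp only [mem_tensor, mem_cograph, mem_graph, mem_comp]
    constructor
    · rintro ⟨h2, h1⟩
      have h3 := congrArg (· ≫ fst _ _) h1
      have h4 := congrArg (· ≫ snd _ _) h1
      simp at h2 h3 h4
      have h5 := h3.symm.trans h4
      refine ⟨b ≫ fst _ _, ?_, ?_⟩ <;> ext <;> simp [← h2, h3, h5]
    · rintro ⟨c, rfl, rfl⟩
      refine ⟨?_, ?_⟩
      · simp
      · ext <;> simp

theorem lax_copy {X Y : C} (R : SpanClass X Y) :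
    R.comp (graph (lift (𝟙 Y) (𝟙 Y))) ≤ (graph (lift (𝟙 X) (𝟙 X))).comp (R.tensor R) := by
  rw [le_iff]
  intro P a b
  rw [mem_comp, mem_graph_comp, mem_tensor]
  rintro ⟨c, h, h'⟩
  rw [mem_graph] at h'
  subst h'
  simpa using h

theorem lax_discard {X Y : C} (R : SpanClass X Y) :
    R.comp (graph (toUnit Y)) ≤ graph (toUnit X) := by
  rw [le_iff]
  intro P a b _
  rw [mem_graph]
  exact toUnit_unique _ _

end

end Cartesian

end SpanClass

/-- The posetal category with the same objects as `C` and `∼`-classes of spans as arrows. As any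
weak pullback gives a composite in the same `∼`-class, composition is formed with pullbacks. -/
@[ext]
structure SpanTilde (C : Type u) where
  /-- The underlying object. -/
  obj : C

namespace SpanTilde

open SpanClass

variable {C : Type u} [Category.{v} C]

noncomputable instance instCategory [HasPullbacks C] : Category.{max u v} (SpanTilde C) where
  Hom X Y := SpanClass X.obj Y.obj
  id X := SpanClass.graph (𝟙 X.obj)
  comp R S := SpanClass.comp R S
  id_comp R := SpanClass.ext fun P a b => by simp [mem_graph_comp]
  comp_id {X Y} R := SpanClass.ext fun P a b => by
    simpa using mem_comp_graph R (Iso.refl Y.obj) a b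
  assoc R S T := SpanClass.comp_assoc R S T

variable [HasPullbacks C]

theorem id_eq (X : SpanTilde C) : 𝟙 X = SpanClass.graph (𝟙 X.obj) := rfl

theorem comp_eq {X Y Z : SpanTilde C} (R : X ⟶ Y) (S : Y ⟶ Z) : R ≫ S = SpanClass.comp R S := rfl

/-- The arrow of `SpanTilde C` given by an arrow of `C`. -/
noncomputable def graphHom {X Y : SpanTilde C} (f : X.obj ⟶ Y.obj) : X ⟶ Y := SpanClass.graph f

theorem id_eq_graphHom (X : SpanTilde C) : 𝟙 X = graphHom (𝟙 X.obj) := rfl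

theorem graphHom_comp_graphHom {X Y Z : SpanTilde C} (f : X.obj ⟶ Y.obj) (g : Y.obj ⟶ Z.obj) :
    (graphHom f : X ⟶ Y) ≫ (graphHom g : Y ⟶ Z) = graphHom (f ≫ g) :=
  SpanClass.graph_comp_graph f g

/-- The isomorphism in `SpanTilde C` given by an isomorphism of `C`. -/
@[simps]
noncomputable def graphIso {X Y : SpanTilde C} (e : X.obj ≅ Y.obj) : X ≅ Y where
  hom := graphHom e.hom
  inv := graphHom e.inv
  hom_inv_id := by rw [graphHom_comp_graphHom, e.hom_inv_id, id_eq_graphHom]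
  inv_hom_id := by rw [graphHom_comp_graphHom, e.inv_hom_id, id_eq_graphHom]

variable [CartesianMonoidalCategory C]

noncomputable instance instMonoidalCategoryStruct : MonoidalCategoryStruct (SpanTilde C) where
  tensorObj X Y := ⟨X.obj ⊗ Y.obj⟩
  tensorUnit := ⟨𝟙_ C⟩
  tensorHom R S := SpanClass.tensor R S
  whiskerLeft X _ _ R := SpanClass.tensor (SpanClass.graph (𝟙 X.obj)) R
  whiskerRight R Y := SpanClass.tensor R (SpanClass.graph (𝟙 Y.obj))
  associator X Y Z := graphIso (α_ X.obj Y.obj Z.obj)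
  leftUnitor X := graphIso (λ_ X.obj)
  rightUnitor X := graphIso (ρ_ X.obj)

theorem tensor_obj (X Y : SpanTilde C) : (X ⊗ Y).obj = X.obj ⊗ Y.obj := rfl

theorem unit_obj : (𝟙_ (SpanTilde C)).obj = 𝟙_ C := rfl

theorem graphHom_tensor_graphHom {X₁ Y₁ X₂ Y₂ : SpanTilde C} (f : X₁.obj ⟶ Y₁.obj)
    (g : X₂.obj ⟶ Y₂.obj) :
    (graphHom f : X₁ ⟶ Y₁) ⊗ₘ (graphHom g : X₂ ⟶ Y₂) =
      (graphHom (X := X₁ ⊗ X₂) (Y := Y₁ ⊗ Y₂) (f ⊗ₘ g)) :=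
  SpanClass.graph_tensor_graph f g

theorem associator_eq (X Y Z : SpanTilde C) :
    α_ X Y Z = graphIso (α_ X.obj Y.obj Z.obj) := rfl

theorem leftUnitor_eq (X : SpanTilde C) : λ_ X = graphIso (λ_ X.obj) := rfl

theorem rightUnitor_eq (X : SpanTilde C) : ρ_ X = graphIso (ρ_ X.obj) := rfl

noncomputable instance instMonoidalCategory : MonoidalCategory (SpanTilde C) :=
  MonoidalCategory.ofTensorHom
    (id_tensorHom_id := fun X₁ X₂ => by
      rw [id_eq_graphHom, id_eq_graphHom, graphHom_tensor_graphHom,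
        MonoidalCategory.id_tensorHom_id, id_eq_graphHom]; rfl)
    (id_tensorHom := fun _ _ _ _ => rfl)
    (tensorHom_id := fun _ _ => rfl)
    (tensorHom_comp_tensorHom := fun f₁ f₂ g₁ g₂ => SpanClass.tensor_comp_tensor f₁ f₂ g₁ g₂)
    (associator_naturality := fun f₁ f₂ f₃ => SpanClass.associator_naturality f₁ f₂ f₃)
    (leftUnitor_naturality := fun f => SpanClass.leftUnitor_naturality f)
    (rightUnitor_naturality := fun f => SpanClass.rightUnitor_naturality f)
    (pentagon := fun W X Y Z => by
      simp only [associator_eq, graphIso_hom, id_eq_graphHom, graphHom_tensor_graphHom,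
        graphHom_comp_graphHom]
      exact congrArg SpanClass.graph (by
        rw [MonoidalCategory.tensorHom_id, MonoidalCategory.id_tensorHom]
        exact MonoidalCategory.pentagon W.obj X.obj Y.obj Z.obj))
    (triangle := fun X Y => by
      simp only [associator_eq, leftUnitor_eq, rightUnitor_eq, graphIso_hom, id_eq_graphHom,
        graphHom_tensor_graphHom, graphHom_comp_graphHom]
      exact congrArg SpanClass.graph (by
        rw [MonoidalCategory.tensorHom_id, MonoidalCategory.id_tensorHom]
        exact MonoidalCategory.triangle X.obj Y.obj))

theorem whiskerLeft_graphHom (Z : SpanTilde C) {X Y : SpanTilde C} (f : X.obj ⟶ Y.obj) :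
    Z ◁ (graphHom f : X ⟶ Y) = graphHom (X := Z ⊗ X) (Y := Z ⊗ Y) (Z.obj ◁ f) := by
  rw [← MonoidalCategory.id_tensorHom, id_eq_graphHom]
  exact (SpanClass.graph_tensor_graph _ f).trans
    (congrArg SpanClass.graph (MonoidalCategory.id_tensorHom _ _))

theorem graphHom_whiskerRight {X Y : SpanTilde C} (f : X.obj ⟶ Y.obj) (Z : SpanTilde C) :
    (graphHom f : X ⟶ Y) ▷ Z = graphHom (X := X ⊗ Z) (Y := Y ⊗ Z) (f ▷ Z.obj) := by
  rw [← MonoidalCategory.tensorHom_id, id_eq_graphHom]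
  exact (SpanClass.graph_tensor_graph f _).trans
    (congrArg SpanClass.graph (MonoidalCategory.tensorHom_id _ _))

noncomputable instance instSymmetricCategory : SymmetricCategory (SpanTilde C) where
  braiding X Y := graphIso (prodSwap X.obj Y.obj)
  braiding_naturality_right X _ _ f := SpanClass.prodSwap_naturality _ f
  braiding_naturality_left f _ := SpanClass.prodSwap_naturality f _
  hexagon_forward X Y Z := by
    simp only [associator_eq, graphIso_hom, graphHom_whiskerRight,
      whiskerLeft_graphHom, graphHom_comp_graphHom]
    refine congrArg SpanClass.graph ?_
    simp only [tensor_obj, prodSwap]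
    ext <;> simp
  hexagon_reverse X Y Z := by
    simp only [associator_eq, graphIso_hom, graphIso_inv, graphHom_whiskerRight,
      whiskerLeft_graphHom, graphHom_comp_graphHom]
    refine congrArg SpanClass.graph ?_
    simp only [tensor_obj, prodSwap]
    ext <;> simp
  symmetry X Y := by
    simp only [graphIso_hom, graphHom_comp_graphHom, id_eq_graphHom]
    refine congrArg SpanClass.graph ?_
    simp only [tensor_obj, prodSwap]
    ext <;> simp

theorem braiding_eq (X Y : SpanTilde C) : β_ X Y = graphIso (prodSwap X.obj Y.obj) := rfl

/-- Copying is the span `X = X → X × X` with right leg the diagonal, discarding is the span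
`X = X → 1`. -/
noncomputable instance instComonObj (X : SpanTilde C) : ComonObj X where
  comul := graphHom (Y := X ⊗ X) (lift (𝟙 X.obj) (𝟙 X.obj))
  counit := graphHom (Y := 𝟙_ (SpanTilde C)) (toUnit X.obj)
  counit_comul := by
    simp only [leftUnitor_eq, graphIso_inv, graphHom_whiskerRight, graphHom_comp_graphHom]
    refine congrArg SpanClass.graph ?_
    simp only [tensor_obj, unit_obj]
    ext
    simp
  comul_counit := by
    simp only [rightUnitor_eq, graphIso_inv, whiskerLeft_graphHom, graphHom_comp_graphHom]
    refine congrArg SpanClass.graph ?_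
    simp only [tensor_obj, unit_obj]
    ext
    simp
  comul_assoc := by
    simp only [associator_eq, graphIso_hom, whiskerLeft_graphHom, graphHom_whiskerRight,
      graphHom_comp_graphHom]
    refine congrArg SpanClass.graph ?_
    simp only [tensor_obj]
    ext <;> simp

theorem comul_eq (X : SpanTilde C) :
    Δ[X] = graphHom (Y := X ⊗ X) (lift (𝟙 X.obj) (𝟙 X.obj)) := rfl

theorem counit_eq (X : SpanTilde C) :
    ε[X] = graphHom (Y := 𝟙_ (SpanTilde C)) (toUnit X.obj) := rfl

instance instIsCommComonObj (X : SpanTilde C) : IsCommComonObj X where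
  comul_comm := by
    simp only [comul_eq, braiding_eq, graphIso_hom, graphHom_comp_graphHom]
    refine congrArg SpanClass.graph ?_
    simp only [tensor_obj, prodSwap]
    ext <;> simp

noncomputable instance instCopyDiscardCategory : CopyDiscardCategory (SpanTilde C) where
  copy_tensor X Y := by
    simp only [comul_eq, tensorμ, associator_eq, braiding_eq, graphIso_hom, graphIso_inv,
      whiskerLeft_graphHom, graphHom_whiskerRight, graphHom_tensor_graphHom,
      graphHom_comp_graphHom]
    refine congrArg SpanClass.graph ?_
    simp only [tensor_obj, prodSwap]
    ext <;> simp
  discard_tensor X Y := by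
    simp only [counit_eq, leftUnitor_eq, graphIso_hom, graphHom_tensor_graphHom,
      graphHom_comp_graphHom]
    exact congrArg SpanClass.graph (toUnit_unique _ _)
  copy_unit := by
    simp only [comul_eq, leftUnitor_eq, graphIso_inv]
    refine congrArg SpanClass.graph ?_
    simp only [tensor_obj, unit_obj]
    ext
  discard_unit := congrArg SpanClass.graph (toUnit_unique _ _)

/-- The monoid operations are the spans opposite to the comonoid operations. -/
noncomputable instance instCartesianBicategory : CartesianBicategory (SpanTilde C) where
  homOrder X Y := inferInstanceAs (PartialOrder (SpanClass X.obj Y.obj))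
  comp_le_comp h h' := SpanClass.comp_le_comp h h'
  tensor_le_tensor h h' := SpanClass.tensor_le_tensor h h'
  cocopy X := SpanClass.cograph (lift (𝟙 X.obj) (𝟙 X.obj))
  codiscard X := SpanClass.cograph (toUnit X.obj)
  id_le_copy_cocopy X := SpanClass.id_le_graph_comp_cograph (lift (𝟙 X.obj) (𝟙 X.obj))
  cocopy_copy_le_id X := SpanClass.cograph_comp_graph_le_id (lift (𝟙 X.obj) (𝟙 X.obj))
  id_le_discard_codiscard X := SpanClass.id_le_graph_comp_cograph (toUnit X.obj)
  codiscard_discard_le_id X := SpanClass.cograph_comp_graph_le_id (toUnit X.obj)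
  frobenius_left X := SpanClass.frobenius_left X.obj
  frobenius_right X := SpanClass.frobenius_right X.obj
  lax_copy R := SpanClass.lax_copy R
  lax_discard R := SpanClass.lax_discard R

end SpanTilde

/-! ### Relations in a regular category -/

/-- Jointly mono spans, ordered by the existence of a morphism of spans. -/
abbrev JMSpan {C : Type u} [Category.{v} C] [CartesianMonoidalCategory C] (X Y : C) :
    Type (max u v) :=
  {S : CSpan X Y // S.JointlyMono}

namespace JMSpan

section Basic

variable {C : Type u} [Category.{v} C] [CartesianMonoidalCategory C]

/-- The jointly mono span `X = X → Y`. -/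
def graph {X Y : C} (f : X ⟶ Y) : JMSpan X Y :=
  ⟨CSpan.mk (𝟙 X) f, ⟨fun g h e => by simpa using congrArg (· ≫ fst _ _) e⟩⟩

/-- The jointly mono span `Y ← X = X`. -/
def cograph {X Y : C} (f : X ⟶ Y) : JMSpan Y X :=
  ⟨CSpan.mk f (𝟙 X), ⟨fun g h e => by simpa using congrArg (· ≫ snd _ _) e⟩⟩

/-- The product of two jointly mono spans. -/
def tensor {X₁ Y₁ X₂ Y₂ : C} (S : JMSpan X₁ Y₁) (T : JMSpan X₂ Y₂) :
    JMSpan (X₁ ⊗ X₂) (Y₁ ⊗ Y₂) :=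
  ⟨S.1.tensor T.1, ⟨fun g h e => by
    have hS : Mono (lift S.1.l S.1.r) := S.2
    have hT : Mono (lift T.1.l T.1.r) := T.2
    have e1 := congrArg (· ≫ fst _ _) e
    have e2 := congrArg (· ≫ snd _ _) e
    simp only [Category.assoc, lift_fst, lift_snd] at e1 e2
    ext
    · rw [← cancel_mono (lift S.1.l S.1.r)]
      ext
      · simpa using congrArg (· ≫ fst _ _) e1
      · simpa using congrArg (· ≫ fst _ _) e2
    · rw [← cancel_mono (lift T.1.l T.1.r)]
      ext
      · simpa using congrArg (· ≫ snd _ _) e1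
      · simpa using congrArg (· ≫ snd _ _) e2⟩⟩

theorem mem_of_strongEpi {X Y : C} (T : JMSpan X Y) {P Q : C} (q : Q ⟶ P) [StrongEpi q]
    {a : P ⟶ X} {b : P ⟶ Y} (h : T.1.Mem (q ≫ a) (q ≫ b)) : T.1.Mem a b := by
  obtain ⟨s, h1, h2⟩ := h
  have hT : Mono (lift T.1.l T.1.r) := T.2
  have sq : CommSq s q (lift T.1.l T.1.r) (lift a b) := ⟨by ext <;> simp [h1, h2]⟩
  refine ⟨sq.lift, ?_, ?_⟩
  · simpa using congrArg (· ≫ fst _ _) sq.fac_right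
  · simpa using congrArg (· ≫ snd _ _) sq.fac_right

end Basic

variable {C : Type u} [Category.{v} C] [CartesianMonoidalCategory C] [Regular C]

/-- The image of a span: the jointly mono span given by the regular epi-mono factorisation of the
induced arrow `A → X × Y`. -/
noncomputable def image {X Y : C} (S : CSpan X Y) : JMSpan X Y :=
  ⟨CSpan.mk ((Regular.strongEpiMonoFactorisation (lift S.l S.r)).m ≫ fst X Y)
      ((Regular.strongEpiMonoFactorisation (lift S.l S.r)).m ≫ snd X Y), by
    have : lift ((Regular.strongEpiMonoFactorisation (lift S.l S.r)).m ≫ fst X Y)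
        ((Regular.strongEpiMonoFactorisation (lift S.l S.r)).m ≫ snd X Y) =
        (Regular.strongEpiMonoFactorisation (lift S.l S.r)).m := by ext <;> simp
    unfold CSpan.JointlyMono
    rw [this]
    infer_instance⟩

theorem mem_image {X Y : C} (S : CSpan X Y) {P : C} {a : P ⟶ X} {b : P ⟶ Y} :
    (image S).1.Mem a b ↔
      ∃ (Q : C) (q : Q ⟶ P), IsRegularEpi q ∧ S.Mem (q ≫ a) (q ≫ b) := by
  have hfac := (Regular.strongEpiMonoFactorisation (lift S.l S.r)).fac
  have h1 := congrArg (· ≫ fst _ _) hfac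
  have h2 := congrArg (· ≫ snd _ _) hfac
  simp only [Category.assoc, lift_fst, lift_snd] at h1 h2
  have hmem : ∀ {P : C} (a : P ⟶ X) (b : P ⟶ Y), (image S).1.Mem a b ↔
      ∃ s : P ⟶ (Regular.strongEpiMonoFactorisation (lift S.l S.r)).I,
        s ≫ (Regular.strongEpiMonoFactorisation (lift S.l S.r)).m ≫ fst X Y = a ∧
        s ≫ (Regular.strongEpiMonoFactorisation (lift S.l S.r)).m ≫ snd X Y = b :=
    fun _ _ => Iff.rfl
  constructor
  · rw [hmem]
    rintro ⟨s, rfl, rfl⟩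
    refine ⟨_, pullback.fst s (Regular.strongEpiMonoFactorisation (lift S.l S.r)).e,
      inferInstance, pullback.snd s (Regular.strongEpiMonoFactorisation (lift S.l S.r)).e, ?_, ?_⟩
    · rw [pullback.condition_assoc, h1]
    · rw [pullback.condition_assoc, h2]
  · rintro ⟨Q, q, hq, h⟩
    refine mem_of_strongEpi (image S) q ?_
    rw [hmem]
    obtain ⟨s, h3, h4⟩ := h
    refine ⟨s ≫ (Regular.strongEpiMonoFactorisation (lift S.l S.r)).e, ?_, ?_⟩
    · rw [← h3, Category.assoc]
      exact congrArg (s ≫ ·) h1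
    · rw [← h4, Category.assoc]
      exact congrArg (s ≫ ·) h2

theorem image_le_iff {X Y : C} {S : CSpan X Y} {T : JMSpan X Y} : image S ≤ T ↔ S ≤ T.1 := by
  rw [← Subtype.coe_le_coe, CSpan.le_iff, CSpan.le_iff]
  constructor
  · intro h P a b hS
    exact h P a b ((mem_image S).2 ⟨P, 𝟙 P, inferInstance, by simpa using hS⟩)
  · intro h P a b hS
    obtain ⟨Q, q, hq, h'⟩ := (mem_image S).1 hS
    exact mem_of_strongEpi T q (h _ _ _ h')

end JMSpan

/-- Jointly mono spans modulo isomorphism: for jointly mono spans, `S ≤ T` and `T ≤ S` hold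
exactly when `S` and `T` are isomorphic. -/
abbrev RelClass {C : Type u} [Category.{v} C] [CartesianMonoidalCategory C] (X Y : C) :
    Type (max u v) :=
  Antisymmetrization (JMSpan X Y) (· ≤ ·)

namespace RelClass

section Basic

variable {C : Type u} [Category.{v} C] [CartesianMonoidalCategory C]

/-- The class of a jointly mono span. -/
abbrev mk {X Y : C} (S : JMSpan X Y) : RelClass X Y := toAntisymmetrization (· ≤ ·) S

theorem ind {X Y : C} {p : RelClass X Y → Prop} (h : ∀ S : JMSpan X Y, p (mk S))
    (R : RelClass X Y) : p R := Quotient.ind' h R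

/-- The underlying span of a jointly mono span. -/
def toSpan {X Y : C} (R : RelClass X Y) : SpanClass X Y :=
  Quotient.map (sa := AntisymmRel.setoid _ _) (sb := AntisymmRel.setoid _ _) Subtype.val
    (fun _ _ h => h) R

theorem toSpan_le_toSpan {X Y : C} {R S : RelClass X Y} : R.toSpan ≤ S.toSpan ↔ R ≤ S := by
  induction R using ind with | h R
  induction S using ind with | h S
  exact Iff.rfl

/-- The class of the jointly mono span `X = X → Y`. -/
def graph {X Y : C} (f : X ⟶ Y) : RelClass X Y := mk (JMSpan.graph f)

/-- The class of the jointly mono span `Y ← X = X`. -/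
def cograph {X Y : C} (f : X ⟶ Y) : RelClass Y X := mk (JMSpan.cograph f)

theorem toSpan_graph {X Y : C} (f : X ⟶ Y) : (graph f).toSpan = SpanClass.graph f := rfl

theorem toSpan_cograph {X Y : C} (f : X ⟶ Y) : (cograph f).toSpan = SpanClass.cograph f := rfl

/-- The product of classes of jointly mono spans. -/
def tensor {X₁ Y₁ X₂ Y₂ : C} (R : RelClass X₁ Y₁) (S : RelClass X₂ Y₂) :
    RelClass (X₁ ⊗ X₂) (Y₁ ⊗ Y₂) :=
  Quotient.map₂ (sa := AntisymmRel.setoid _ _) (sb := AntisymmRel.setoid _ _)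
    (sc := AntisymmRel.setoid _ _) JMSpan.tensor (fun R R' h S S' h' =>
      ⟨SpanClass.tensor_le_tensor (R := SpanClass.mk R.1) (R' := SpanClass.mk R'.1)
        (S := SpanClass.mk S.1) (S' := SpanClass.mk S'.1) h.1 h'.1,
       SpanClass.tensor_le_tensor (R := SpanClass.mk R'.1) (R' := SpanClass.mk R.1)
        (S := SpanClass.mk S'.1) (S' := SpanClass.mk S.1) h.2 h'.2⟩) R S

theorem toSpan_tensor {X₁ Y₁ X₂ Y₂ : C} (R : RelClass X₁ Y₁) (S : RelClass X₂ Y₂) :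
    (R.tensor S).toSpan = R.toSpan.tensor S.toSpan := by
  induction R using ind with | h R
  induction S using ind with | h S
  rfl

theorem tensor_le_tensor {X₁ Y₁ X₂ Y₂ : C} {R R' : RelClass X₁ Y₁} {S S' : RelClass X₂ Y₂}
    (h : R ≤ R') (h' : S ≤ S') : R.tensor S ≤ R'.tensor S' := by
  rw [← toSpan_le_toSpan, toSpan_tensor, toSpan_tensor]
  exact SpanClass.tensor_le_tensor (toSpan_le_toSpan.2 h) (toSpan_le_toSpan.2 h')

theorem mem_of_strongEpi {X Y : C} (R : RelClass X Y) {P Q : C} (q : Q ⟶ P) [StrongEpi q]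
    {a : P ⟶ X} {b : P ⟶ Y} (h : R.toSpan.Mem (q ≫ a) (q ≫ b)) : R.toSpan.Mem a b := by
  induction R using ind with | h R
  exact JMSpan.mem_of_strongEpi R q h

end Basic

variable {C : Type u} [Category.{v} C] [CartesianMonoidalCategory C] [Regular C]

/-- The image of a class of spans. -/
noncomputable def image {X Y : C} (R : SpanClass X Y) : RelClass X Y :=
  Quotient.map (sa := AntisymmRel.setoid _ _) (sb := AntisymmRel.setoid _ _) JMSpan.image
    (fun _ _ h => ⟨JMSpan.image_le_iff.2 (h.1.trans (JMSpan.image_le_iff.1 le_rfl)),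
      JMSpan.image_le_iff.2 (h.2.trans (JMSpan.image_le_iff.1 le_rfl))⟩) R

theorem image_le_iff {X Y : C} {R : SpanClass X Y} {S : RelClass X Y} :
    image R ≤ S ↔ R ≤ S.toSpan := by
  induction R using SpanClass.ind with | h R
  induction S using ind with | h S
  exact JMSpan.image_le_iff

theorem image_toSpan {X Y : C} (R : RelClass X Y) : image R.toSpan = R :=
  le_antisymm (image_le_iff.2 le_rfl) (toSpan_le_toSpan.1 (image_le_iff.1 le_rfl))

theorem image_surjective {X Y : C} (R : RelClass X Y) : ∃ S : SpanClass X Y, image S = R :=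
  ⟨_, image_toSpan R⟩

theorem image_mono {X Y : C} {R S : SpanClass X Y} (h : R ≤ S) : image R ≤ image S :=
  image_le_iff.2 (h.trans (image_le_iff.1 le_rfl))

theorem mem_toSpan_image {X Y : C} (R : SpanClass X Y) {P : C} (a : P ⟶ X) (b : P ⟶ Y) :
    (image R).toSpan.Mem a b ↔
      ∃ (Q : C) (q : Q ⟶ P), IsRegularEpi q ∧ R.Mem (q ≫ a) (q ≫ b) := by
  induction R using SpanClass.ind with | h R
  exact JMSpan.mem_image R

/-- The composite of two relations: the image of their composite as spans. -/
noncomputable def comp {X Y Z : C} (R : RelClass X Y) (S : RelClass Y Z) : RelClass X Z :=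
  image (R.toSpan.comp S.toSpan)

theorem image_comp {X Y Z : C} (R : SpanClass X Y) (S : SpanClass Y Z) :
    (image R).comp (image S) = image (R.comp S) := by
  apply le_antisymm
  · refine image_le_iff.2 (SpanClass.le_iff.2 fun P a c h => ?_)
    obtain ⟨b, h1, h2⟩ := (SpanClass.mem_comp _ _ _ _).1 h
    obtain ⟨Q, q, hq, h1⟩ := (mem_toSpan_image _ _ _).1 h1
    obtain ⟨Q', q', hq', h2⟩ := (mem_toSpan_image _ _ _).1 h2
    have : StrongEpi (pullback.fst q q' ≫ q) := strongEpi_comp _ _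
    refine mem_of_strongEpi _ (pullback.fst q q' ≫ q) ?_
    refine SpanClass.le_iff.1 (image_le_iff.1 le_rfl) _ _ _ ?_
    refine (SpanClass.mem_comp _ _ _ _).2 ⟨(pullback.fst q q' ≫ q) ≫ b, ?_, ?_⟩
    · simpa using h1.precomp (pullback.fst q q')
    · simpa [pullback.condition_assoc] using h2.precomp (pullback.snd q q')
  · exact image_mono (SpanClass.comp_le_comp (image_le_iff.1 le_rfl) (image_le_iff.1 le_rfl))

theorem image_tensor {X₁ Y₁ X₂ Y₂ : C} (R : SpanClass X₁ Y₁) (S : SpanClass X₂ Y₂) :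
    (image R).tensor (image S) = image (R.tensor S) := by
  apply le_antisymm
  · refine toSpan_le_toSpan.1 (SpanClass.le_iff.2 fun P a c h => ?_)
    rw [toSpan_tensor] at h
    obtain ⟨h1, h2⟩ := (SpanClass.mem_tensor _ _ _ _).1 h
    obtain ⟨Q, q, hq, h1⟩ := (mem_toSpan_image _ _ _).1 h1
    obtain ⟨Q', q', hq', h2⟩ := (mem_toSpan_image _ _ _).1 h2
    have : StrongEpi (pullback.fst q q' ≫ q) := strongEpi_comp _ _
    refine mem_of_strongEpi _ (pullback.fst q q' ≫ q) ?_
    refine SpanClass.le_iff.1 (image_le_iff.1 le_rfl) _ _ _ ?_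
    refine (SpanClass.mem_tensor _ _ _ _).2 ⟨?_, ?_⟩
    · simpa using h1.precomp (pullback.fst q q')
    · simpa [pullback.condition_assoc] using h2.precomp (pullback.snd q q')
  · refine image_le_iff.2 ?_
    rw [toSpan_tensor]
    exact SpanClass.tensor_le_tensor (image_le_iff.1 le_rfl) (image_le_iff.1 le_rfl)

theorem image_graph {X Y : C} (f : X ⟶ Y) : image (SpanClass.graph f) = graph f :=
  image_toSpan (graph f)

theorem image_cograph {X Y : C} (f : X ⟶ Y) : image (SpanClass.cograph f) = cograph f :=
  image_toSpan (cograph f)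

theorem comp_le_comp {X Y Z : C} {R R' : RelClass X Y} {S S' : RelClass Y Z}
    (h : R ≤ R') (h' : S ≤ S') : R.comp S ≤ R'.comp S' :=
  image_mono (SpanClass.comp_le_comp (toSpan_le_toSpan.2 h) (toSpan_le_toSpan.2 h'))

theorem tensor_comp_tensor {X₁ Y₁ Z₁ X₂ Y₂ Z₂ : C} (f₁ : RelClass X₁ Y₁)
    (f₂ : RelClass X₂ Y₂) (g₁ : RelClass Y₁ Z₁) (g₂ : RelClass Y₂ Z₂) :
    (f₁.tensor f₂).comp (g₁.tensor g₂) = (f₁.comp g₁).tensor (f₂.comp g₂) := by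
  obtain ⟨f₁, rfl⟩ := image_surjective f₁
  obtain ⟨f₂, rfl⟩ := image_surjective f₂
  obtain ⟨g₁, rfl⟩ := image_surjective g₁
  obtain ⟨g₂, rfl⟩ := image_surjective g₂
  simp only [image_tensor, image_comp, SpanClass.tensor_comp_tensor]

theorem associator_naturality {X₁ X₂ X₃ Y₁ Y₂ Y₃ : C} (f₁ : RelClass X₁ Y₁)
    (f₂ : RelClass X₂ Y₂) (f₃ : RelClass X₃ Y₃) :
    ((f₁.tensor f₂).tensor f₃).comp (graph (α_ Y₁ Y₂ Y₃).hom) =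
      (graph (α_ X₁ X₂ X₃).hom).comp (f₁.tensor (f₂.tensor f₃)) := by
  obtain ⟨f₁, rfl⟩ := image_surjective f₁
  obtain ⟨f₂, rfl⟩ := image_surjective f₂
  obtain ⟨f₃, rfl⟩ := image_surjective f₃
  simp only [← image_graph, image_tensor, image_comp, SpanClass.associator_naturality]

theorem leftUnitor_naturality {X Y : C} (f : RelClass X Y) :
    ((graph (𝟙 (𝟙_ C))).tensor f).comp (graph (λ_ Y).hom) = (graph (λ_ X).hom).comp f := by
  obtain ⟨f, rfl⟩ := image_surjective f
  simp only [← image_graph, image_tensor, image_comp, SpanClass.leftUnitor_naturality]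

theorem rightUnitor_naturality {X Y : C} (f : RelClass X Y) :
    (f.tensor (graph (𝟙 (𝟙_ C)))).comp (graph (ρ_ Y).hom) = (graph (ρ_ X).hom).comp f := by
  obtain ⟨f, rfl⟩ := image_surjective f
  simp only [← image_graph, image_tensor, image_comp, SpanClass.rightUnitor_naturality]

theorem prodSwap_naturality {X₁ Y₁ X₂ Y₂ : C} (f : RelClass X₁ Y₁) (g : RelClass X₂ Y₂) :
    (f.tensor g).comp (graph (SpanClass.prodSwap Y₁ Y₂).hom) =
      (graph (SpanClass.prodSwap X₁ X₂).hom).comp (g.tensor f) := by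
  obtain ⟨f, rfl⟩ := image_surjective f
  obtain ⟨g, rfl⟩ := image_surjective g
  simp only [← image_graph, image_tensor, image_comp, SpanClass.prodSwap_naturality]

theorem graph_tensor_graph {X₁ Y₁ X₂ Y₂ : C} (f : X₁ ⟶ Y₁) (g : X₂ ⟶ Y₂) :
    (graph f).tensor (graph g) = graph (f ⊗ₘ g) := by
  simp only [← image_graph, image_tensor, SpanClass.graph_tensor_graph]

theorem graph_comp_graph {X Y Z : C} (f : X ⟶ Y) (g : Y ⟶ Z) :
    (graph f).comp (graph g) = graph (f ≫ g) := by
  simp only [← image_graph, image_comp, SpanClass.graph_comp_graph]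

theorem id_le_graph_comp_cograph {X Y : C} (f : X ⟶ Y) :
    graph (𝟙 X) ≤ (graph f).comp (cograph f) := by
  simp only [← image_graph, ← image_cograph, image_comp]
  exact image_mono (SpanClass.id_le_graph_comp_cograph f)

theorem cograph_comp_graph_le_id {X Y : C} (f : X ⟶ Y) :
    (cograph f).comp (graph f) ≤ graph (𝟙 Y) := by
  simp only [← image_graph, ← image_cograph, image_comp]
  exact image_mono (SpanClass.cograph_comp_graph_le_id f)

theorem frobenius_left (X : C) :
    ((graph (𝟙 X)).tensor (graph (lift (𝟙 X) (𝟙 X)))).comp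
      ((graph (α_ X X X).inv).comp ((cograph (lift (𝟙 X) (𝟙 X))).tensor (graph (𝟙 X)))) =
      (cograph (lift (𝟙 X) (𝟙 X))).comp (graph (lift (𝟙 X) (𝟙 X))) := by
  simp only [← image_graph, ← image_cograph, image_comp, image_tensor, SpanClass.frobenius_left]

theorem frobenius_right (X : C) :
    ((graph (lift (𝟙 X) (𝟙 X))).tensor (graph (𝟙 X))).comp
      ((graph (α_ X X X).hom).comp ((graph (𝟙 X)).tensor (cograph (lift (𝟙 X) (𝟙 X))))) =
      (cograph (lift (𝟙 X) (𝟙 X))).comp (graph (lift (𝟙 X) (𝟙 X))) := by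
  simp only [← image_graph, ← image_cograph, image_comp, image_tensor, SpanClass.frobenius_right]

theorem lax_copy {X Y : C} (R : RelClass X Y) :
    R.comp (graph (lift (𝟙 Y) (𝟙 Y))) ≤ (graph (lift (𝟙 X) (𝟙 X))).comp (R.tensor R) := by
  obtain ⟨R, rfl⟩ := image_surjective R
  simp only [← image_graph, image_comp, image_tensor]
  exact image_mono (SpanClass.lax_copy R)

theorem lax_discard {X Y : C} (R : RelClass X Y) :
    R.comp (graph (toUnit Y)) ≤ graph (toUnit X) := by
  obtain ⟨R, rfl⟩ := image_surjective R
  simp only [← image_graph, image_comp]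
  exact image_mono (SpanClass.lax_discard R)

end RelClass

/-- The posetal category with the same objects as the regular category `C` and jointly mono spans
as arrows. -/
@[ext]
structure RelC (C : Type u) where
  /-- The underlying object. -/
  obj : C

namespace RelC

open RelClass

variable {C : Type u} [Category.{v} C] [CartesianMonoidalCategory C] [Regular C]

noncomputable instance instCategory : Category.{max u v} (RelC C) where
  Hom X Y := RelClass X.obj Y.obj
  id X := RelClass.graph (𝟙 X.obj)
  comp R S := RelClass.comp R S
  id_comp {X Y} R := by
    obtain ⟨R, rfl⟩ := image_surjective R
    rw [← image_graph, image_comp]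
    exact congrArg image (Category.id_comp (X := (⟨X.obj⟩ : SpanTilde C)) (Y := ⟨Y.obj⟩) R)
  comp_id {X Y} R := by
    obtain ⟨R, rfl⟩ := image_surjective R
    rw [← image_graph, image_comp]
    exact congrArg image (Category.comp_id (X := (⟨X.obj⟩ : SpanTilde C)) (Y := ⟨Y.obj⟩) R)
  assoc {X Y Z W} R S T := by
    obtain ⟨R, rfl⟩ := image_surjective R
    obtain ⟨S, rfl⟩ := image_surjective S
    obtain ⟨T, rfl⟩ := image_surjective T
    rw [image_comp, image_comp, image_comp, image_comp, SpanClass.comp_assoc]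

/-- The arrow of `RelC C` given by an arrow of `C`. -/
noncomputable def graphHom {X Y : RelC C} (f : X.obj ⟶ Y.obj) : X ⟶ Y := RelClass.graph f

theorem id_eq_graphHom (X : RelC C) : 𝟙 X = graphHom (𝟙 X.obj) := rfl

theorem graphHom_comp_graphHom {X Y Z : RelC C} (f : X.obj ⟶ Y.obj) (g : Y.obj ⟶ Z.obj) :
    (graphHom f : X ⟶ Y) ≫ (graphHom g : Y ⟶ Z) = graphHom (f ≫ g) :=
  RelClass.graph_comp_graph f g

/-- The isomorphism in `RelC C` given by an isomorphism of `C`. -/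
@[simps]
noncomputable def graphIso {X Y : RelC C} (e : X.obj ≅ Y.obj) : X ≅ Y where
  hom := graphHom e.hom
  inv := graphHom e.inv
  hom_inv_id := by rw [graphHom_comp_graphHom, e.hom_inv_id, id_eq_graphHom]
  inv_hom_id := by rw [graphHom_comp_graphHom, e.inv_hom_id, id_eq_graphHom]

noncomputable instance instMonoidalCategoryStruct : MonoidalCategoryStruct (RelC C) where
  tensorObj X Y := ⟨X.obj ⊗ Y.obj⟩
  tensorUnit := ⟨𝟙_ C⟩
  tensorHom R S := RelClass.tensor R S
  whiskerLeft X _ _ R := RelClass.tensor (RelClass.graph (𝟙 X.obj)) R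
  whiskerRight R Y := RelClass.tensor R (RelClass.graph (𝟙 Y.obj))
  associator X Y Z := graphIso (α_ X.obj Y.obj Z.obj)
  leftUnitor X := graphIso (λ_ X.obj)
  rightUnitor X := graphIso (ρ_ X.obj)

theorem tensor_obj (X Y : RelC C) : (X ⊗ Y).obj = X.obj ⊗ Y.obj := rfl

theorem unit_obj : (𝟙_ (RelC C)).obj = 𝟙_ C := rfl

theorem graphHom_tensor_graphHom {X₁ Y₁ X₂ Y₂ : RelC C} (f : X₁.obj ⟶ Y₁.obj)
    (g : X₂.obj ⟶ Y₂.obj) :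
    (graphHom f : X₁ ⟶ Y₁) ⊗ₘ (graphHom g : X₂ ⟶ Y₂) =
      (graphHom (X := X₁ ⊗ X₂) (Y := Y₁ ⊗ Y₂) (f ⊗ₘ g)) :=
  RelClass.graph_tensor_graph f g

theorem associator_eq (X Y Z : RelC C) :
    α_ X Y Z = graphIso (α_ X.obj Y.obj Z.obj) := rfl

theorem leftUnitor_eq (X : RelC C) : λ_ X = graphIso (λ_ X.obj) := rfl

theorem rightUnitor_eq (X : RelC C) : ρ_ X = graphIso (ρ_ X.obj) := rfl

noncomputable instance instMonoidalCategory : MonoidalCategory (RelC C) :=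
  MonoidalCategory.ofTensorHom
    (id_tensorHom_id := fun X₁ X₂ => by
      rw [id_eq_graphHom, id_eq_graphHom, graphHom_tensor_graphHom,
        MonoidalCategory.id_tensorHom_id, id_eq_graphHom]; rfl)
    (id_tensorHom := fun _ _ _ _ => rfl)
    (tensorHom_id := fun _ _ => rfl)
    (tensorHom_comp_tensorHom := fun f₁ f₂ g₁ g₂ => RelClass.tensor_comp_tensor f₁ f₂ g₁ g₂)
    (associator_naturality := fun f₁ f₂ f₃ => RelClass.associator_naturality f₁ f₂ f₃)
    (leftUnitor_naturality := fun f => RelClass.leftUnitor_naturality f)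
    (rightUnitor_naturality := fun f => RelClass.rightUnitor_naturality f)
    (pentagon := fun W X Y Z => by
      simp only [associator_eq, graphIso_hom, id_eq_graphHom, graphHom_tensor_graphHom,
        graphHom_comp_graphHom]
      exact congrArg RelClass.graph (by
        rw [MonoidalCategory.tensorHom_id, MonoidalCategory.id_tensorHom]
        exact MonoidalCategory.pentagon W.obj X.obj Y.obj Z.obj))
    (triangle := fun X Y => by
      simp only [associator_eq, leftUnitor_eq, rightUnitor_eq, graphIso_hom, id_eq_graphHom,
        graphHom_tensor_graphHom, graphHom_comp_graphHom]
      exact congrArg RelClass.graph (by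
        rw [MonoidalCategory.tensorHom_id, MonoidalCategory.id_tensorHom]
        exact MonoidalCategory.triangle X.obj Y.obj))

theorem whiskerLeft_graphHom (Z : RelC C) {X Y : RelC C} (f : X.obj ⟶ Y.obj) :
    Z ◁ (graphHom f : X ⟶ Y) = graphHom (X := Z ⊗ X) (Y := Z ⊗ Y) (Z.obj ◁ f) := by
  rw [← MonoidalCategory.id_tensorHom, id_eq_graphHom]
  exact (RelClass.graph_tensor_graph _ f).trans
    (congrArg RelClass.graph (MonoidalCategory.id_tensorHom _ _))

theorem graphHom_whiskerRight {X Y : RelC C} (f : X.obj ⟶ Y.obj) (Z : RelC C) :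
    (graphHom f : X ⟶ Y) ▷ Z = graphHom (X := X ⊗ Z) (Y := Y ⊗ Z) (f ▷ Z.obj) := by
  rw [← MonoidalCategory.tensorHom_id, id_eq_graphHom]
  exact (RelClass.graph_tensor_graph f _).trans
    (congrArg RelClass.graph (MonoidalCategory.tensorHom_id _ _))

noncomputable instance instSymmetricCategory : SymmetricCategory (RelC C) where
  braiding X Y := graphIso (SpanClass.prodSwap X.obj Y.obj)
  braiding_naturality_right X _ _ f := RelClass.prodSwap_naturality _ f
  braiding_naturality_left f _ := RelClass.prodSwap_naturality f _
  hexagon_forward X Y Z := by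
    simp only [associator_eq, graphIso_hom, graphHom_whiskerRight,
      whiskerLeft_graphHom, graphHom_comp_graphHom]
    refine congrArg RelClass.graph ?_
    simp only [tensor_obj, SpanClass.prodSwap]
    ext <;> simp
  hexagon_reverse X Y Z := by
    simp only [associator_eq, graphIso_hom, graphIso_inv, graphHom_whiskerRight,
      whiskerLeft_graphHom, graphHom_comp_graphHom]
    refine congrArg RelClass.graph ?_
    simp only [tensor_obj, SpanClass.prodSwap]
    ext <;> simp
  symmetry X Y := by
    simp only [graphIso_hom, graphHom_comp_graphHom, id_eq_graphHom]
    refine congrArg RelClass.graph ?_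
    simp only [tensor_obj, SpanClass.prodSwap]
    ext <;> simp

theorem braiding_eq (X Y : RelC C) : β_ X Y = graphIso (SpanClass.prodSwap X.obj Y.obj) := rfl

/-- Copying is the span `X = X → X × X` with right leg the diagonal, discarding is the span
`X = X → 1`. -/
noncomputable instance instComonObj (X : RelC C) : ComonObj X where
  comul := graphHom (Y := X ⊗ X) (lift (𝟙 X.obj) (𝟙 X.obj))
  counit := graphHom (Y := 𝟙_ (RelC C)) (toUnit X.obj)
  counit_comul := by
    simp only [leftUnitor_eq, graphIso_inv, graphHom_whiskerRight, graphHom_comp_graphHom]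
    refine congrArg RelClass.graph ?_
    simp only [tensor_obj, unit_obj]
    ext
    simp
  comul_counit := by
    simp only [rightUnitor_eq, graphIso_inv, whiskerLeft_graphHom, graphHom_comp_graphHom]
    refine congrArg RelClass.graph ?_
    simp only [tensor_obj, unit_obj]
    ext
    simp
  comul_assoc := by
    simp only [associator_eq, graphIso_hom, whiskerLeft_graphHom, graphHom_whiskerRight,
      graphHom_comp_graphHom]
    refine congrArg RelClass.graph ?_
    simp only [tensor_obj]
    ext <;> simp

theorem comul_eq (X : RelC C) :
    Δ[X] = graphHom (Y := X ⊗ X) (lift (𝟙 X.obj) (𝟙 X.obj)) := rfl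

theorem counit_eq (X : RelC C) :
    ε[X] = graphHom (Y := 𝟙_ (RelC C)) (toUnit X.obj) := rfl

instance instIsCommComonObj (X : RelC C) : IsCommComonObj X where
  comul_comm := by
    simp only [comul_eq, braiding_eq, graphIso_hom, graphHom_comp_graphHom]
    refine congrArg RelClass.graph ?_
    simp only [tensor_obj, SpanClass.prodSwap]
    ext <;> simp

noncomputable instance instCopyDiscardCategory : CopyDiscardCategory (RelC C) where
  copy_tensor X Y := by
    simp only [comul_eq, tensorμ, associator_eq, braiding_eq, graphIso_hom, graphIso_inv,
      whiskerLeft_graphHom, graphHom_whiskerRight, graphHom_tensor_graphHom,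
      graphHom_comp_graphHom]
    refine congrArg RelClass.graph ?_
    simp only [tensor_obj, SpanClass.prodSwap]
    ext <;> simp
  discard_tensor X Y := by
    simp only [counit_eq, leftUnitor_eq, graphIso_hom, graphHom_tensor_graphHom,
      graphHom_comp_graphHom]
    exact congrArg RelClass.graph (toUnit_unique _ _)
  copy_unit := by
    simp only [comul_eq, leftUnitor_eq, graphIso_inv]
    refine congrArg RelClass.graph ?_
    simp only [tensor_obj, unit_obj]
    ext
  discard_unit := congrArg RelClass.graph (toUnit_unique _ _)

/-- The monoid operations are the spans opposite to the comonoid operations. -/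
noncomputable instance instCartesianBicategory : CartesianBicategory (RelC C) where
  homOrder X Y := inferInstanceAs (PartialOrder (RelClass X.obj Y.obj))
  comp_le_comp h h' := RelClass.comp_le_comp h h'
  tensor_le_tensor h h' := RelClass.tensor_le_tensor h h'
  cocopy X := RelClass.cograph (lift (𝟙 X.obj) (𝟙 X.obj))
  codiscard X := RelClass.cograph (toUnit X.obj)
  id_le_copy_cocopy X := RelClass.id_le_graph_comp_cograph (lift (𝟙 X.obj) (𝟙 X.obj))
  cocopy_copy_le_id X := RelClass.cograph_comp_graph_le_id (lift (𝟙 X.obj) (𝟙 X.obj))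
  id_le_discard_codiscard X := RelClass.id_le_graph_comp_cograph (toUnit X.obj)
  codiscard_discard_le_id X := RelClass.cograph_comp_graph_le_id (toUnit X.obj)
  frobenius_left X := RelClass.frobenius_left X.obj
  frobenius_right X := RelClass.frobenius_right X.obj
  lax_copy R := RelClass.lax_copy R
  lax_discard R := RelClass.lax_discard R

end RelC

/-! The proof rests on the maps of the two bicategories, that is, the arrows with a right adjoint.

In `SpanTilde C` and in `RelC C` alike they are exactly the graphs of arrows of `C`, the right
adjoint of a graph being the opposite span (`SpanClass.exists_graph`, `RelClass.exists_graph`).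
A functor `SpanTilde C ⥤ RelC C` which is monotone on arrows preserves adjunctions, so it induces
an endofunctor of `C` (`onMaps`), and this is an equivalence if the given functor is an equivalence
that also reflects the order.  What distinguishes the two bicategories is the meaning of the
equation `cograph f ≫ graph f = 𝟙`: for spans it says that `f` is a split epimorphism, for
relations it holds for every regular epimorphism.  If `f` is a regular epimorphism, then its image
under the induced equivalence is one too, so the equation holds in `RelC C` for that image; since
the functor is faithful, it holds in `SpanTilde C` for `f`, and `f` splits.

Conversely, taking images is always a functor `SpanTilde C ⥤ RelC C` that is the identity on
objects, full, and strictly compatible with the cartesian bicategory structure.  If regular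
epimorphisms split, a pair of generalized elements belongs to the image of a span only if it
belongs to the span itself, so the functor reflects the order (`RelClass.image_le_image_iff`). -/

/-! ### Maps in the bicategory of spans -/

namespace SpanClass

variable {C : Type u} [Category.{v} C]

theorem graph_injective {X Y : C} {f g : X ⟶ Y} (h : graph f = graph g) : f = g := by
  have h1 : (graph g).Mem (𝟙 X) f := h ▸ (mem_graph f _ _).2 (Category.id_comp f)
  simpa using ((mem_graph g _ _).1 h1).symm

/-- A left adjoint in the bicategory of spans is the graph of an arrow, and its right adjoint is
the opposite span. -/
theorem exists_graph [HasPullbacks C] {X Y : C} {R : SpanClass X Y} {S : SpanClass Y X}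
    (hu : graph (𝟙 X) ≤ R.comp S) (hc : S.comp R ≤ graph (𝟙 Y)) :
    ∃ f : X ⟶ Y, R = graph f ∧ S = cograph f := by
  have hc' : ∀ {P : C} {y : P ⟶ Y} (x : P ⟶ X) {y' : P ⟶ Y}, S.Mem y x → R.Mem x y' → y = y' := by
    intro P y x y' h h'
    simpa [mem_graph] using le_iff.1 hc P y y' ((mem_comp _ _ _ _).2 ⟨x, h, h'⟩)
  obtain ⟨f, hR, hS⟩ := (mem_comp _ _ _ _).1
    (le_iff.1 hu X (𝟙 X) (𝟙 X) ((mem_graph _ _ _).2 (Category.id_comp _)))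
  refine ⟨f, ext fun P a b => ?_, ext fun P b a => ?_⟩
  · rw [mem_graph]
    constructor
    · intro h
      exact hc' a (by simpa using hS.precomp a) h
    · rintro rfl
      simpa using hR.precomp a
  · rw [mem_cograph]
    constructor
    · intro h
      exact (hc' a h (by simpa using hR.precomp a)).symm
    · rintro rfl
      simpa using hS.precomp a

theorem isSplitEpi_of_id_le_cograph_comp_graph [HasPullbacks C] {X Y : C} {f : X ⟶ Y}
    (h : graph (𝟙 Y) ≤ (cograph f).comp (graph f)) : IsSplitEpi f := by
  obtain ⟨s, hs, -⟩ := (mem_comp _ _ _ _).1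
    (le_iff.1 h Y (𝟙 Y) (𝟙 Y) ((mem_graph _ _ _).2 (Category.id_comp _)))
  exact ⟨⟨s, (mem_cograph _ _ _).1 hs⟩⟩

end SpanClass

/-! ### Maps in the bicategory of relations -/

namespace RelClass

section

variable {C : Type u} [Category.{v} C] [CartesianMonoidalCategory C]

theorem graph_injective {X Y : C} {f g : X ⟶ Y} (h : graph f = graph g) : f = g :=
  SpanClass.graph_injective (congrArg toSpan h)

theorem toSpan_injective {X Y : C} {R S : RelClass X Y} (h : R.toSpan = S.toSpan) : R = S :=
  le_antisymm (toSpan_le_toSpan.1 h.le) (toSpan_le_toSpan.1 h.ge)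

end

variable {C : Type u} [Category.{v} C] [CartesianMonoidalCategory C] [Regular C]

/-- A left adjoint in the bicategory of relations is the graph of an arrow, and its right adjoint
is the opposite span.  The unit yields a value of the relation only on a regular epimorphic cover
of its source; by the counit these values agree on the kernel pair of the cover, so they descend. -/
theorem exists_graph {X Y : C} {R : RelClass X Y} {S : RelClass Y X}
    (hu : graph (𝟙 X) ≤ R.comp S) (hc : S.comp R ≤ graph (𝟙 Y)) :
    ∃ f : X ⟶ Y, R = graph f ∧ S = cograph f := by
  have hc' : ∀ {P : C} {y : P ⟶ Y} (x : P ⟶ X) {y' : P ⟶ Y},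
      S.toSpan.Mem y x → R.toSpan.Mem x y' → y = y' := by
    intro P y x y' h h'
    have := SpanClass.le_iff.1 (image_le_iff.1 hc) P y y'
      ((SpanClass.mem_comp _ _ _ _).2 ⟨x, h, h'⟩)
    rw [toSpan_graph, SpanClass.mem_graph] at this
    simpa using this
  obtain ⟨Q, q, hq, h⟩ := (mem_toSpan_image _ _ _).1 (SpanClass.le_iff.1 (toSpan_le_toSpan.2 hu)
    X (𝟙 X) (𝟙 X) ((SpanClass.mem_graph _ _ _).2 (Category.id_comp _)))
  rw [SpanClass.mem_comp] at h
  obtain ⟨b, hR, hS⟩ := h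
  rw [Category.comp_id] at hR hS
  have hb : IsRegularEpi.left q ≫ b = IsRegularEpi.right q ≫ b := by
    refine hc' (IsRegularEpi.left q ≫ q) (hS.precomp _) ?_
    rw [IsRegularEpi.w q]
    exact hR.precomp _
  have hfac := IsRegularEpi.fac q b hb
  generalize IsRegularEpi.desc q b hb = f at hfac
  subst hfac
  have hR1 : R.toSpan.Mem (𝟙 X) f := mem_of_strongEpi R q (by simpa using hR)
  have hS1 : S.toSpan.Mem f (𝟙 X) := mem_of_strongEpi S q (by simpa using hS)
  refine ⟨f, toSpan_injective (SpanClass.ext fun P a b => ?_),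
    toSpan_injective (SpanClass.ext fun P b a => ?_)⟩
  · rw [toSpan_graph, SpanClass.mem_graph]
    constructor
    · intro h
      exact hc' a (by simpa using hS1.precomp a) h
    · rintro rfl
      simpa using hR1.precomp a
  · rw [toSpan_cograph, SpanClass.mem_cograph]
    constructor
    · intro h
      exact (hc' a h (by simpa using hR1.precomp a)).symm
    · rintro rfl
      simpa using hS1.precomp a

theorem id_le_cograph_comp_graph {X Y : C} (f : X ⟶ Y) [IsRegularEpi f] :
    graph (𝟙 Y) ≤ (cograph f).comp (graph f) := by
  refine toSpan_le_toSpan.1 (SpanClass.le_iff.2 fun P a b h => ?_)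
  rw [toSpan_graph, SpanClass.mem_graph, Category.comp_id] at h
  subst h
  refine (mem_toSpan_image _ _ _).2 ⟨_, pullback.fst a f, inferInstance, ?_⟩
  rw [SpanClass.mem_comp]
  refine ⟨pullback.snd a f, ?_, ?_⟩
  · rw [toSpan_cograph, SpanClass.mem_cograph, pullback.condition]
  · rw [toSpan_graph, SpanClass.mem_graph, pullback.condition]

/-- If regular epimorphisms split, the cover witnessing membership in an image has a section. -/
theorem image_le_image_iff (hC : ∀ (X Y : C) (f : X ⟶ Y), IsRegularEpi f → IsSplitEpi f)
    {X Y : C} {R S : SpanClass X Y} : image R ≤ image S ↔ R ≤ S := by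
  refine ⟨fun h => SpanClass.le_iff.2 fun P a b hR => ?_, image_mono⟩
  obtain ⟨Q, q, hq, h'⟩ := (mem_toSpan_image _ _ _).1
    (SpanClass.le_iff.1 (image_le_iff.1 h) P a b hR)
  have := hC _ _ q hq
  simpa using h'.precomp (section_ q)

end RelClass

/-! ### The endofunctor induced on the base category -/

namespace SpanTilde

variable {C : Type u} [Category.{v} C] [CartesianMonoidalCategory C] [Regular C]

/-- The right adjoint of `graphHom f`. -/
def cographHom {X Y : SpanTilde C} (f : X.obj ⟶ Y.obj) : Y ⟶ X := SpanClass.cograph f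

theorem exists_map_graph (F : CartesianBicategory.Morphism (SpanTilde C) (RelC C)) {X Y : C}
    (f : X ⟶ Y) : ∃ g : (F.functor.obj ⟨X⟩).obj ⟶ (F.functor.obj ⟨Y⟩).obj,
      F.functor.map (graphHom (X := ⟨X⟩) (Y := ⟨Y⟩) f) = RelC.graphHom g ∧
      F.functor.map (cographHom (X := ⟨X⟩) (Y := ⟨Y⟩) f) = RelClass.cograph g := by
  refine RelClass.exists_graph ?_ ?_
  · have h : 𝟙 (⟨X⟩ : SpanTilde C) ≤
        graphHom (X := ⟨X⟩) (Y := ⟨Y⟩) f ≫ cographHom (X := ⟨X⟩) (Y := ⟨Y⟩) f :=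
      SpanClass.id_le_graph_comp_cograph f
    have h' := F.map_le_map h
    rw [CategoryTheory.Functor.map_id, Functor.map_comp] at h'
    exact h'
  · have h : cographHom (X := ⟨X⟩) (Y := ⟨Y⟩) f ≫ graphHom (X := ⟨X⟩) (Y := ⟨Y⟩) f ≤
        𝟙 (⟨Y⟩ : SpanTilde C) :=
      SpanClass.cograph_comp_graph_le_id f
    have h' := F.map_le_map h
    rw [CategoryTheory.Functor.map_id, Functor.map_comp] at h'
    exact h'

/-- The endofunctor of the base category given by the action of a morphism
`SpanTilde C → RelC C` on maps, both bicategories having the arrows of `C` as their maps. -/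
noncomputable def onMaps (F : CartesianBicategory.Morphism (SpanTilde C) (RelC C)) : C ⥤ C where
  obj X := (F.functor.obj ⟨X⟩).obj
  map f := (exists_map_graph F f).choose
  map_id X := by
    refine RelClass.graph_injective ((exists_map_graph F (𝟙 X)).choose_spec.1.symm.trans ?_)
    exact F.functor.map_id _
  map_comp {X Y Z} f g := by
    refine RelClass.graph_injective ((exists_map_graph F (f ≫ g)).choose_spec.1.symm.trans ?_)
    rw [← graphHom_comp_graphHom (X := ⟨X⟩) (Y := ⟨Y⟩) (Z := ⟨Z⟩), Functor.map_comp]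
    exact (congrArg₂ (· ≫ ·) (exists_map_graph F f).choose_spec.1
      (exists_map_graph F g).choose_spec.1).trans (RelC.graphHom_comp_graphHom _ _)

theorem map_graphHom (F : CartesianBicategory.Morphism (SpanTilde C) (RelC C)) {X Y : C}
    (f : X ⟶ Y) : F.functor.map (graphHom (X := ⟨X⟩) (Y := ⟨Y⟩) f) =
      RelC.graphHom ((onMaps F).map f) :=
  (exists_map_graph F f).choose_spec.1

theorem map_cographHom (F : CartesianBicategory.Morphism (SpanTilde C) (RelC C)) {X Y : C}
    (f : X ⟶ Y) : F.functor.map (cographHom (X := ⟨X⟩) (Y := ⟨Y⟩) f) =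
      RelClass.cograph ((onMaps F).map f) :=
  (exists_map_graph F f).choose_spec.2

theorem onMaps_isEquivalence {F : CartesianBicategory.Morphism (SpanTilde C) (RelC C)}
    (hF : F.IsBiequivalence) : (onMaps F).IsEquivalence := by
  have := hF.1
  have hfaithful : (onMaps F).Faithful := ⟨fun {X Y f g} h => by
    refine SpanClass.graph_injective (F.functor.map_injective
      (X := (⟨X⟩ : SpanTilde C)) (Y := ⟨Y⟩) ?_)
    exact (map_graphHom F f).trans ((congrArg RelClass.graph h).trans (map_graphHom F g).symm)⟩
  have hfull : (onMaps F).Full := ⟨fun {X Y} g => by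
    obtain ⟨R, hR⟩ := F.functor.map_surjective (X := (⟨X⟩ : SpanTilde C)) (Y := ⟨Y⟩)
      (RelC.graphHom g)
    obtain ⟨S, hS⟩ := F.functor.map_surjective (X := (⟨Y⟩ : SpanTilde C)) (Y := ⟨X⟩)
      (RelClass.cograph g)
    have hu : 𝟙 (⟨X⟩ : SpanTilde C) ≤ R ≫ S := hF.2 _ _ _ _ (by
      rw [CategoryTheory.Functor.map_id, Functor.map_comp, hR, hS]
      exact RelClass.id_le_graph_comp_cograph g)
    have hc : S ≫ R ≤ 𝟙 (⟨Y⟩ : SpanTilde C) := hF.2 _ _ _ _ (by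
      rw [CategoryTheory.Functor.map_id, Functor.map_comp, hR, hS]
      exact RelClass.cograph_comp_graph_le_id g)
    obtain ⟨f, rfl, -⟩ := SpanClass.exists_graph hu hc
    exact ⟨f, RelClass.graph_injective ((map_graphHom F f).symm.trans hR)⟩⟩
  have hsurj : (onMaps F).EssSurj := ⟨fun Y => by
    let e := F.functor.objObjPreimageIso (⟨Y⟩ : RelC C)
    -- An isomorphism and its inverse are left adjoint to one another, hence both are graphs.
    obtain ⟨f, hf, -⟩ := RelClass.exists_graph (R := e.hom) (S := e.inv)
      e.hom_inv_id.ge e.inv_hom_id.le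
    obtain ⟨g, hg, -⟩ := RelClass.exists_graph (R := e.inv) (S := e.hom)
      e.inv_hom_id.ge e.hom_inv_id.le
    refine ⟨(F.functor.objPreimage (⟨Y⟩ : RelC C)).obj, ⟨⟨f, g, ?_, ?_⟩⟩⟩
    · refine RelClass.graph_injective ((RelClass.graph_comp_graph f g).symm.trans ?_)
      rw [← hf, ← hg]
      exact e.hom_inv_id
    · refine RelClass.graph_injective ((RelClass.graph_comp_graph g f).symm.trans ?_)
      rw [← hf, ← hg]
      exact e.inv_hom_id⟩
  exact { faithful := hfaithful, full := hfull, essSurj := hsurj }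

theorem isSplitEpi_of_isBiequivalence
    {F : CartesianBicategory.Morphism (SpanTilde C) (RelC C)} (hF : F.IsBiequivalence)
    {X Y : C} (f : X ⟶ Y) [IsRegularEpi f] : IsSplitEpi f := by
  have := onMaps_isEquivalence hF
  -- In a regular category the regular epimorphisms are the strong ones, and an equivalence
  -- preserves strong epimorphisms.
  have : IsRegularEpi ((onMaps F).map f) := inferInstance
  refine SpanClass.isSplitEpi_of_id_le_cograph_comp_graph
    (hF.2 ⟨Y⟩ ⟨Y⟩ (𝟙 (⟨Y⟩ : SpanTilde C))
      (cographHom (X := ⟨X⟩) (Y := ⟨Y⟩) f ≫ graphHom (X := ⟨X⟩) (Y := ⟨Y⟩) f) ?_)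
  rw [CategoryTheory.Functor.map_id, Functor.map_comp, map_graphHom, map_cographHom]
  exact RelClass.id_le_cograph_comp_graph ((onMaps F).map f)

/-! ### The image morphism -/

variable (C) in
/-- The functor sending a span to its image, the identity on objects. -/
noncomputable def imageFunctor : SpanTilde C ⥤ RelC C where
  obj X := ⟨X.obj⟩
  map R := RelClass.image R
  map_id X := RelClass.image_graph (𝟙 X.obj)
  map_comp R S := (RelClass.image_comp R S).symm

theorem imageFunctor_map_graphHom {X Y : SpanTilde C} (f : X.obj ⟶ Y.obj) :
    (imageFunctor C).map (graphHom f : X ⟶ Y) =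
      (RelC.graphHom (X := (imageFunctor C).obj X) (Y := (imageFunctor C).obj Y) f) :=
  RelClass.image_graph f

variable (C) in
/-- The strict monoidal structure of `imageFunctor`. -/
noncomputable def imageFunctorCoreMonoidal : (imageFunctor C).CoreMonoidal where
  εIso := Iso.refl (𝟙_ (RelC C))
  μIso X Y := Iso.refl ((imageFunctor C).obj X ⊗ (imageFunctor C).obj Y)
  μIso_hom_natural_left {X Y} f X' := by
    refine (Category.comp_id _).trans (Eq.trans ?_ (Category.id_comp _).symm)
    exact (congrArg (RelClass.tensor _) (RelClass.image_graph (𝟙 X'.obj)).symm).trans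
      (RelClass.image_tensor f (SpanClass.graph (𝟙 X'.obj)))
  μIso_hom_natural_right {X Y} X' f := by
    refine (Category.comp_id _).trans (Eq.trans ?_ (Category.id_comp _).symm)
    exact (congrArg (RelClass.tensor · _) (RelClass.image_graph (𝟙 X'.obj)).symm).trans
      (RelClass.image_tensor (SpanClass.graph (𝟙 X'.obj)) f)
  -- `erw` is needed since the unit and tensor of `SpanTilde C` are sent to those of `RelC C` only
  -- after unfolding `imageFunctor`.
  associativity X Y Z := by
    rw [associator_eq, graphIso_hom, imageFunctor_map_graphHom]
    simp only [Iso.refl_hom]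
    erw [MonoidalCategory.id_whiskerRight, MonoidalCategory.whiskerLeft_id, Category.id_comp,
      Category.id_comp, Category.id_comp, Category.comp_id]
    rfl
  left_unitality X := by
    rw [leftUnitor_eq, graphIso_hom, imageFunctor_map_graphHom]
    simp only [Iso.refl_hom]
    erw [MonoidalCategory.id_whiskerRight, Category.id_comp, Category.id_comp]
    rfl
  right_unitality X := by
    rw [rightUnitor_eq, graphIso_hom, imageFunctor_map_graphHom]
    simp only [Iso.refl_hom]
    erw [MonoidalCategory.whiskerLeft_id, Category.id_comp, Category.id_comp]
    rfl

variable (C) in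
/-- Taking images, as a morphism of cartesian bicategories. -/
noncomputable def imageMorphism : CartesianBicategory.Morphism (SpanTilde C) (RelC C) where
  functor := imageFunctor C
  monoidal := (imageFunctorCoreMonoidal C).toMonoidal
  map_le_map h := RelClass.image_mono h
  map_copy X := (RelClass.image_graph _).trans
    (Category.comp_id Δ[(imageFunctor C).obj X]).symm
  map_discard X := (RelClass.image_graph _).trans
    (Category.comp_id ε[(imageFunctor C).obj X]).symm
  map_cocopy X := (RelClass.image_cograph _).trans
    (Category.id_comp (CartesianBicategory.cocopy ((imageFunctor C).obj X))).symm
  map_codiscard X := (RelClass.image_cograph _).trans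
    (Category.id_comp (CartesianBicategory.codiscard ((imageFunctor C).obj X))).symm

theorem imageMorphism_isIsomorphism
    (hC : ∀ (X Y : C) (f : X ⟶ Y), IsRegularEpi f → IsSplitEpi f) :
    (imageMorphism C).IsIsomorphism :=
  ⟨{ faithful := ⟨fun h => le_antisymm
        ((RelClass.image_le_image_iff hC).1 (le_of_eq h))
        ((RelClass.image_le_image_iff hC).1 (ge_of_eq h))⟩
     full := ⟨fun R => RelClass.image_surjective R⟩
     bijective_obj := ⟨fun _ _ h => SpanTilde.ext (congrArg RelC.obj h), fun Y => ⟨⟨Y.obj⟩, rfl⟩⟩ },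
    fun _ _ _ _ h => (RelClass.image_le_image_iff hC).1 h⟩

end SpanTilde

theorem CartesianBicategory.Morphism.IsIsomorphism.isBiequivalence {B : Type*} [Category B]
    [MonoidalCategory B] [CartesianBicategory B] {B' : Type*} [Category B']
    [MonoidalCategory B'] [CartesianBicategory B'] {F : CartesianBicategory.Morphism B B'}
    (hF : F.IsIsomorphism) : F.IsBiequivalence := by
  have := hF.1
  exact ⟨inferInstance, hF.2⟩

/-- For a regular category `C` (with any choice of finite products), the cartesian bicategories
`SpanTilde C` and `RelC C` are isomorphic iff every regular epimorphism of `C` splits, and likewise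
they are biequivalent iff every regular epimorphism of `C` splits. -/
theorem mainTheorem9 (C : Type u) [Category.{v} C] [CartesianMonoidalCategory C] [Regular C] :
    ((∃ F : CartesianBicategory.Morphism (SpanTilde C) (RelC C), F.IsIsomorphism) ↔
      ∀ (X Y : C) (f : X ⟶ Y), IsRegularEpi f → IsSplitEpi f) ∧
    ((∃ F : CartesianBicategory.Morphism (SpanTilde C) (RelC C), F.IsBiequivalence) ↔
      ∀ (X Y : C) (f : X ⟶ Y), IsRegularEpi f → IsSplitEpi f) := by
  refine ⟨⟨?_, fun hC => ⟨_, SpanTilde.imageMorphism_isIsomorphism hC⟩⟩,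
    ⟨?_, fun hC => ⟨_, (SpanTilde.imageMorphism_isIsomorphism hC).isBiequivalence⟩⟩⟩
  · rintro ⟨F, hF⟩ X Y f hf
    exact SpanTilde.isSplitEpi_of_isBiequivalence hF.isBiequivalence f
  · rintro ⟨F, hF⟩ X Y f hf
    exact SpanTilde.isSplitEpi_of_isBiequivalence hF f
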